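/- Let $k$ be an algebraically closed field, $\Gamma=(\Gamma_0,\Gamma_1,s,e)$ a finite acyclic quiver, and $\mathcal A=(A_i)_{i\in\Gamma_0}$ a family of finite-dimensional basic $k$-algebras, each with a fixed presentation $A_i\cong k\Sigma_i/\Omega_i$, where $\Sigma_i$ is a finite quiver and $\Omega_i$ an admissible ideal. Write $\overline{\gamma}\in A_i$ for the class of a path $\gamma$ of $\Sigma_i$. Let $I$ be a set of relations over $\Gamma$ (each a $k$-linear combination of paths with common start and common end) generating an admissible ideal of $k\Gamma$. An $\mathcal A$-path is a sequence $a_1\beta_1a_2\cdots a_n\beta_na_{n+1}$ ($n\ge 0$), where $\beta_1\cdots\beta_n$ is a path of $\Gamma$ and each $a_r$ is an element of the algebra at the vertex where it stands. The generalized path algebra $k(\Gamma,\mathcal A)$ is the span of the $\mathcal A$-paths modulo multilinearity in the entries $a_r$, with $(a_1\beta_1\cdots\beta_na_{n+1})(b_1\gamma_1\cdots\gamma_mb_{m+1})=a_1\beta_1\cdots\beta_n(a_{n+1}b_1)\gamma_1\cdots\gamma_mb_{m+1}$ if the first path ends where the second begins, and $0$ otherwise. Let $\Lambda=k(\Gamma,\mathcal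 A,I)$ be its quotient by the two-sided ideal generated by all elements $\sum_r\lambda_r\,\beta_{r1}\overline{\gamma_{r1}}\beta_{r2}\cdots\overline{\gamma_{r(m_r-1)}}\beta_{rm_r}$ with $\sum_r\lambda_r\,\beta_{r1}\cdots\beta_{rm_r}\in I$ and $\gamma_{rt}$ any path of the quiver $\Sigma_{e(\beta_{rt})}$. Modules are right modules. A representation of $\Lambda$ consists of $A_l$-modules $M_l$ $(l\in\Gamma_0)$ and $k$-linear maps $\phi_\alpha:M_{s(\alpha)}\to M_{e(\alpha)}$ $(\alpha\in\Gamma_1)$ such that for all such $\lambda_r,\beta_{rt},\gamma_{rt}$ one has $\sum_r\lambda_r\,\phi_{\beta_{rm_r}}\circ\overline{\gamma_{r(m_r-1)}}\circ\cdots\circ\overline{\gamma_{r1}}\circ\phi_{\beta_{r1}}=0$, where an element of an algebra denotes right multiplication by it. The representation of a $\Lambda$-module $X$ is given by $M_l=X\cdot 1_l$, where $1_l$ is the identity of $A_l$, and $\phi_\alpha(x)=x\alpha$. The radical $\operatorname{rad}X$ of a module $X$ is the intersection of its maximal submodules. For each $i$ let $e_{i1},\dots,e_{is_i}$ be a complete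 set of pairwise orthogonal primitive idempotents of $A_i$, and let $P_i^j=e_{ij}A_i$ and $P(i,j)=\overline{e_{ij}}\Lambda$, where $\overline{a}$ is the class in $\Lambda$ of $a\in A_i$. **Proposition.** Let $i\in\Gamma_0$, $1\le j\le s_i$, and let $((M_l)_{l\in\Gamma_0},(\phi_\alpha)_{\alpha\in\Gamma_1})$ be the representation of $P(i,j)$. Then $x\mapsto\overline{x}$ is an isomorphism of $A_i$-modules $P_i^j\to M_i$. Identify $P_i^j$ with $M_i$ through it, and put $N_i=\operatorname{rad}P_i^j$ and $N_l=M_l$ for $l\ne i$. Then $\phi_\alpha(N_{s(\alpha)})\subseteq N_{e(\alpha)}$ for every $\alpha\in\Gamma_1$, and the representation of $\operatorname{rad}P(i,j)$ is $((N_l)_{l\in\Gamma_0},(\psi_\alpha)_{\alpha\in\Gamma_1})$, where $\psi_\alpha$ is the restriction of $\phi_\alpha$ to $N_{s(\alpha)}$; more precisely, there is an isomorphism between these two representations whose composite with the inclusion of $((N_l),(\psi_\alpha))$ into $((M_l),(\phi_\alpha))$ is the morphism induced by the inclusion $\operatorname{rad}P(i,j)\subseteq P(i,j)$. -/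

import Mathlib

universe uk uΓ va vv us vs w w'

set_option linter.unusedSectionVars false
set_option linter.checkUnivs false

noncomputable section

open MulOpposite

/-! ## The algebra of a finite family of composable Hom-spaces

For a finite set `V` and `k`-vector spaces `H i j` (`i j : V`) with an associative unital `k`-bilinear
composition `H i j × H j l → H i l`, the space `⨁ i j, H i j` is a unital algebra; elements of
`H i j` and `H j' l` with `j ≠ j'` multiply to zero and the identity is the sum of the local ones. -/

/-- An associative, unital, `k`-bilinear composition on a family of `k`-vector spaces. -/
class LinComp (k : Type*) [Field k] {V : Type*} (H : V → V → Type*)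
    [∀ i j, AddCommGroup (H i j)] [∀ i j, Module k (H i j)] where
  comp : ∀ {i j l : V}, H i j →ₗ[k] H j l →ₗ[k] H i l
  idn : ∀ i : V, H i i
  comp_assoc : ∀ {i j l m : V} (f : H i j) (g : H j l) (h : H l m),
    comp (comp f g) h = comp f (comp g h)
  idn_comp : ∀ {i j : V} (f : H i j), comp (idn i) f = f
  comp_idn : ∀ {i j : V} (f : H i j), comp f (idn j) = f

/-- The direct sum `⨁ i j, H i j` over the finite set `V × V`. -/
def CompAlg (k : Type*) {V : Type*} (H : V → V → Type*) : Type _ :=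
  let _ := k
  ∀ i j, H i j

namespace CompAlg

variable {k : Type*} [Field k] {V : Type*} {H : V → V → Type*}
  [∀ i j, AddCommGroup (H i j)] [∀ i j, Module k (H i j)]

instance : AddCommGroup (CompAlg k H) := inferInstanceAs (AddCommGroup (∀ i j, H i j))

instance : Module k (CompAlg k H) := inferInstanceAs (Module k (∀ i j, H i j))

@[ext] theorem ext {f g : CompAlg k H} (h : ∀ i j, f i j = g i j) : f = g :=
  funext fun i => funext fun j => h i j

theorem add_apply (f g : CompAlg k H) (i j : V) : (f + g) i j = f i j + g i j := rfl

theorem smul_apply (c : k) (f : CompAlg k H) (i j : V) : (c • f) i j = c • f i j := rfl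

theorem zero_apply (i j : V) : (0 : CompAlg k H) i j = 0 := rfl

open Classical in
/-- The inclusion of the component `H i j`. -/
def of (k : Type*) {V : Type*} {H : V → V → Type*} [Field k] [∀ i j, AddCommGroup (H i j)]
    [∀ i j, Module k (H i j)] (i j : V) : H i j →ₗ[k] CompAlg k H :=
  (LinearMap.single k (fun i => ∀ j, H i j) i).comp (LinearMap.single k (fun j => H i j) j)

theorem of_same (i j : V) (f : H i j) : of k i j f i j = f := by
  classical
  change Pi.single (M := fun i => ∀ j, H i j) i (Pi.single (M := fun j => H i j) j f) i j = f
  simp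

theorem of_ne_left {i j a b : V} (f : H i j) (h : a ≠ i) : of k i j f a b = 0 := by
  classical
  change Pi.single (M := fun i => ∀ j, H i j) i (Pi.single (M := fun j => H i j) j f) a b = 0
  rw [Pi.single_eq_of_ne h]
  rfl

theorem of_ne_right {i j b : V} (f : H i j) (h : b ≠ j) : of k i j f i b = 0 := by
  classical
  change Pi.single (M := fun i => ∀ j, H i j) i (Pi.single (M := fun j => H i j) j f) i b = 0
  rw [Pi.single_eq_same, Pi.single_eq_of_ne h]

variable [Fintype V] [LinComp k H]

instance : Mul (CompAlg k H) :=
  ⟨fun f g i l => ∑ j, LinComp.comp (k := k) (H := H) (f i j) (g j l)⟩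

open Classical in
instance : One (CompAlg k H) :=
  ⟨fun i => Pi.single i (LinComp.idn (k := k) (H := H) i)⟩

theorem mul_apply (f g : CompAlg k H) (i l : V) :
    (f * g) i l = ∑ j, LinComp.comp (k := k) (H := H) (f i j) (g j l) := rfl

open Classical in
theorem one_apply (i j : V) :
    (1 : CompAlg k H) i j =
      Pi.single (M := fun j => H i j) i (LinComp.idn (k := k) (H := H) i) j := rfl

instance : Ring (CompAlg k H) :=
  { (inferInstance : AddCommGroup (CompAlg k H)),
    (inferInstance : Mul (CompAlg k H)), (inferInstance : One (CompAlg k H)) with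
    left_distrib := fun f g h => by
      ext i j; simp [mul_apply, add_apply, Finset.sum_add_distrib]
    right_distrib := fun f g h => by
      ext i j; simp [mul_apply, add_apply, Finset.sum_add_distrib]
    zero_mul := fun f => by ext i j; simp [mul_apply, zero_apply]
    mul_zero := fun f => by ext i j; simp [mul_apply, zero_apply]
    mul_assoc := fun f g h => by
      ext i l
      simp only [mul_apply, map_sum, LinearMap.sum_apply, LinComp.comp_assoc]
      rw [Finset.sum_comm]
    one_mul := fun f => by
      classical
      ext i j
      rw [mul_apply, Finset.sum_eq_single i]
      · rw [one_apply, Pi.single_eq_same, LinComp.idn_comp]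
      · intro b _ hb
        rw [one_apply, Pi.single_eq_of_ne hb, map_zero, LinearMap.zero_apply]
      · simp
    mul_one := fun f => by
      classical
      ext i j
      rw [mul_apply, Finset.sum_eq_single j]
      · rw [one_apply, Pi.single_eq_same, LinComp.comp_idn]
      · intro b _ hb
        rw [one_apply, Pi.single_eq_of_ne hb.symm, map_zero]
      · simp }

instance : Algebra k (CompAlg k H) :=
  Algebra.ofModule
    (fun c f g => by ext i j; simp [mul_apply, smul_apply, Finset.smul_sum])
    (fun c f g => by ext i j; simp [mul_apply, smul_apply, Finset.smul_sum])

theorem of_mul_of {i j l : V} (f : H i j) (g : H j l) :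
    of k i j f * of k j l g = of k i l (LinComp.comp (k := k) (H := H) f g) := by
  ext a b
  rw [mul_apply]
  by_cases ha : a = i
  · subst ha
    rw [Finset.sum_eq_single j]
    · rw [of_same]
      by_cases hb : b = l
      · subst hb; rw [of_same, of_same]
      · rw [of_ne_right _ hb, of_ne_right _ hb, map_zero]
    · intro c _ hc
      rw [of_ne_right _ hc, map_zero, LinearMap.zero_apply]
    · simp
  · rw [of_ne_left _ ha]
    refine Finset.sum_eq_zero fun c _ => ?_
    rw [of_ne_left _ ha, map_zero, LinearMap.zero_apply]

end CompAlg

/-! ## Path algebras and admissible ideals -/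

/-- The vector space with basis the paths from `i` to `j`. -/
abbrev PathHom (k : Type*) [Field k] (Q : Type*) [Quiver Q] (i j : Q) : Type _ :=
  Quiver.Path i j →₀ k

/-- Composition of linear combinations of paths, extending concatenation bilinearly. -/
def PathHom.comp (k : Type*) [Field k] {Q : Type*} [Quiver Q] {i j l : Q} :
    (Quiver.Path i j →₀ k) →ₗ[k] (Quiver.Path j l →₀ k) →ₗ[k] (Quiver.Path i l →₀ k) :=
  Finsupp.linearCombination k fun p : Quiver.Path i j =>
    Finsupp.lmapDomain k k fun q : Quiver.Path j l => p.comp q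

theorem PathHom.comp_single (k : Type*) [Field k] {Q : Type*} [Quiver Q] {i j l : Q}
    (p : Quiver.Path i j) (q : Quiver.Path j l) (a b : k) :
    PathHom.comp k (Finsupp.single p a) (Finsupp.single q b) =
      Finsupp.single (p.comp q) (a * b) := by
  simp [PathHom.comp]

instance (k : Type*) [Field k] (Q : Type*) [Quiver Q] : LinComp k (PathHom k Q) where
  comp := PathHom.comp k
  idn i := Finsupp.single Quiver.Path.nil 1
  comp_assoc {i j l m} f g h := by
    change PathHom.comp k (PathHom.comp k f g) h = PathHom.comp k f (PathHom.comp k g h)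
    change Quiver.Path i j →₀ k at f
    change Quiver.Path j l →₀ k at g
    change Quiver.Path l m →₀ k at h
    induction f using Finsupp.induction_linear with
    | zero => simp
    | add f₁ f₂ h₁ h₂ => simp only [map_add, LinearMap.add_apply, h₁, h₂]
    | single p a =>
      induction g using Finsupp.induction_linear with
      | zero => simp
      | add f₁ f₂ h₁ h₂ => simp only [map_add, LinearMap.add_apply, h₁, h₂]
      | single q b =>
        induction h using Finsupp.induction_linear with
        | zero => simp
        | add f₁ f₂ h₁ h₂ => simp only [map_add, h₁, h₂]
        | single r c => simp only [PathHom.comp_single, Quiver.Path.comp_assoc, mul_assoc]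
  idn_comp {i j} f := by
    change PathHom.comp k _ f = f
    change Quiver.Path i j →₀ k at f
    induction f using Finsupp.induction_linear with
    | zero => simp
    | add f₁ f₂ h₁ h₂ => simp only [map_add, h₁, h₂]
    | single p a => simp only [PathHom.comp_single, Quiver.Path.nil_comp, one_mul]
  comp_idn {i j} f := by
    change PathHom.comp k f _ = f
    change Quiver.Path i j →₀ k at f
    induction f using Finsupp.induction_linear with
    | zero => simp
    | add f₁ f₂ h₁ h₂ => simp only [map_add, LinearMap.add_apply, h₁, h₂]
    | single p a => simp only [PathHom.comp_single, Quiver.Path.comp_nil, mul_one]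

/-- The path algebra `kQ` of a quiver `Q` with finitely many vertices. -/
abbrev PathAlgebra (k : Type*) [Field k] (Q : Type*) [Quiver Q] : Type _ :=
  CompAlg k (PathHom k Q)

/-- The path `p` as an element of `kQ`. -/
def PathAlgebra.ofPath (k : Type*) [Field k] {Q : Type*} [Quiver Q] {i j : Q}
    (p : Quiver.Path i j) : PathAlgebra k Q :=
  CompAlg.of k (H := PathHom k Q) i j (Finsupp.single p (1 : k) : Quiver.Path i j →₀ k)

/-- The ideal `Rⁿ` of `kQ`, where `R` is the arrow ideal: the ideal generated by the paths of
length at least `n`. -/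
def PathAlgebra.lengthIdeal (k : Type*) [Field k] (Q : Type*) [Quiver Q] [Fintype Q] (n : ℕ) :
    TwoSidedIdeal (PathAlgebra k Q) :=
  TwoSidedIdeal.span
    {x | ∃ (i j : Q) (p : Quiver.Path i j), n ≤ p.length ∧ x = PathAlgebra.ofPath k p}

/-- Admissible ideals: `Rᵐ ⊆ J ⊆ R²` for some `m ≥ 2`. -/
def PathAlgebra.IsAdmissible {k : Type*} [Field k] {Q : Type*} [Quiver Q] [Fintype Q]
    (J : TwoSidedIdeal (PathAlgebra k Q)) : Prop :=
  J ≤ PathAlgebra.lengthIdeal k Q 2 ∧ ∃ m, 2 ≤ m ∧ PathAlgebra.lengthIdeal k Q m ≤ J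

/-- A presentation `B ≅ kΣ/Ω` with `Σ` a finite quiver and `Ω` an admissible ideal, given as the
surjection `kΣ → B` with kernel `Ω`. -/
structure QuiverPresentation (k : Type uk) [Field k] (B : Type va) [Ring B] [Algebra k B] where
  vertex : Type us
  [quiver : Quiver.{vs} vertex]
  [fintype : Fintype vertex]
  finite_arrows : ∀ u v : vertex, Finite (u ⟶ v)
  proj : PathAlgebra k vertex →ₐ[k] B
  surjective : Function.Surjective proj
  admissible : PathAlgebra.IsAdmissible (TwoSidedIdeal.ker proj)

attribute [instance] QuiverPresentation.quiver QuiverPresentation.fintype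

/-- The class in `B` of a path of `Σ`. -/
def QuiverPresentation.bar {k : Type uk} [Field k] {B : Type va} [Ring B] [Algebra k B]
    (π : QuiverPresentation.{uk, va, us, vs} k B) {u v : π.vertex} (σ : Quiver.Path u v) : B :=
  π.proj (PathAlgebra.ofPath k σ)

/-! ## Generalized path algebras -/

/-- `𝒜`-paths `a₁ β₁ a₂ ⋯ aₙ βₙ aₙ₊₁`, where `β₁ ⋯ βₙ` is a path and each `a` lies in the algebra of
the vertex at which it stands; `nil a` has length zero and `cons x β a` is `x β a`. -/
inductive APath {Γ : Type uΓ} [Quiver.{vv} Γ] (A : Γ → Type va) (i : Γ) :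
    Γ → Type (max uΓ vv va)
  | nil (a : A i) : APath A i i
  | cons {j l : Γ} (x : APath A i j) (β : j ⟶ l) (a : A l) : APath A i l

namespace APath

section

variable {Γ : Type uΓ} [Quiver.{vv} Γ] {A : Γ → Type va} [∀ i, Ring (A i)]

/-- Multiply the last entry by `b` on the right. -/
def mulLast {i : Γ} : ∀ {j : Γ}, APath A i j → A j → APath A i j
  | _, nil a, b => nil (a * b)
  | _, cons x β a, b => cons x β (a * b)

/-- `(a₁ β₁ ⋯ βₙ aₙ₊₁)(b₁ γ₁ ⋯ γₘ bₘ₊₁) = a₁ β₁ ⋯ βₙ (aₙ₊₁ b₁) γ₁ ⋯ γₘ bₘ₊₁`. -/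
def comp {i j : Γ} (x : APath A i j) : ∀ {l : Γ}, APath A j l → APath A i l
  | _, nil b => x.mulLast b
  | _, cons y β b => cons (x.comp y) β b

theorem mulLast_mulLast {i j : Γ} (x : APath A i j) (a b : A j) :
    (x.mulLast a).mulLast b = x.mulLast (a * b) := by
  cases x <;> simp [mulLast, mul_assoc]

theorem mulLast_one {i j : Γ} (x : APath A i j) : x.mulLast 1 = x := by
  cases x <;> simp [mulLast]

theorem comp_mulLast {i j l : Γ} (x : APath A i j) (y : APath A j l) (a : A l) :
    x.comp (y.mulLast a) = (x.comp y).mulLast a := by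
  cases y with
  | nil b => exact (mulLast_mulLast x b a).symm
  | cons y β b => rfl

theorem comp_assoc {i j l m : Γ} (x : APath A i j) (y : APath A j l) (z : APath A l m) :
    (x.comp y).comp z = x.comp (y.comp z) := by
  induction z with
  | nil c => simp [comp, comp_mulLast]
  | cons z β c ih => simp [comp, ih]

theorem comp_nil_one {i j : Γ} (x : APath A i j) : x.comp (nil 1) = x := by
  rw [comp, mulLast_one]

theorem nil_one_comp {i j : Γ} (x : APath A i j) : (nil 1 : APath A i i).comp x = x := by
  induction x with
  | nil c => simp [comp, mulLast]
  | cons x β c ih => simp [comp, ih]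

end

/-- `IsSlot f`: the map `f` inserts its argument, an element of `A v`, at one fixed position of an
`𝒜`-path all of whose other entries are fixed. -/
inductive IsSlot {Γ : Type uΓ} [Quiver.{vv} Γ] {A : Γ → Type va} :
    ∀ {v i j : Γ}, (A v → APath A i j) → Prop
  | nil {i : Γ} : IsSlot (fun a : A i => APath.nil a)
  | last {v i j : Γ} (x : APath A i j) (β : j ⟶ v) : IsSlot (fun a : A v => APath.cons x β a)
  | step {v i j l : Γ} {f : A v → APath A i j} (hf : IsSlot f) (β : j ⟶ l) (b : A l) :
      IsSlot (fun a => APath.cons (f a) β b)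

variable (k : Type uk) [Field k] {Γ : Type uΓ} [Quiver.{vv} Γ] (A : Γ → Type va)
  [∀ i, Ring (A i)] [∀ i, Algebra k (A i)]

/-- The subspace of the span of the `𝒜`-paths from `i` to `j` that is generated by the
multilinearity relations in the entries. -/
def multilinRel (i j : Γ) : Submodule k (APath A i j →₀ k) :=
  Submodule.span k
    ({z | ∃ (v : Γ) (f : A v → APath A i j) (a b : A v), IsSlot f ∧
        z = Finsupp.single (f (a + b)) 1 - (Finsupp.single (f a) 1 + Finsupp.single (f b) 1)} ∪
      {z | ∃ (v : Γ) (f : A v → APath A i j) (c : k) (a : A v), IsSlot f ∧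
        z = Finsupp.single (f (c • a)) 1 - c • Finsupp.single (f a) 1})

variable {A}

theorem IsSlot.mulLast {v : Γ} {i j : Γ} {f : A v → APath A i j} (hf : IsSlot f) (b : A j) :
    ∃ (g : A v → APath A i j) (c : A v →ₗ[k] A v), IsSlot g ∧
      ∀ a, (f a).mulLast b = g (c a) := by
  cases hf with
  | nil => exact ⟨_, LinearMap.mulRight k b, .nil, fun a => rfl⟩
  | last x β => exact ⟨_, LinearMap.mulRight k b, .last x β, fun a => rfl⟩
  | step hf β d => exact ⟨_, LinearMap.id, .step hf β (d * b), fun a => rfl⟩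

theorem IsSlot.comp_right {v : Γ} {i j l : Γ} {f : A v → APath A i j} (hf : IsSlot f)
    (y : APath A j l) :
    ∃ (g : A v → APath A i l) (c : A v →ₗ[k] A v), IsSlot g ∧
      ∀ a, (f a).comp y = g (c a) := by
  induction y with
  | nil b => exact hf.mulLast k b
  | cons y β b ih =>
    obtain ⟨g, c, hg, h⟩ := ih
    exact ⟨_, c, .step hg β b, fun a => by simp only [APath.comp, h]⟩

theorem IsSlot.comp_left {v : Γ} {i j l : Γ} {f : A v → APath A j l} (hf : IsSlot f)
    (x : APath A i j) :
    ∃ (g : A v → APath A i l) (c : A v →ₗ[k] A v), IsSlot g ∧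
      ∀ a, x.comp (f a) = g (c a) := by
  induction hf with
  | nil =>
    cases x with
    | nil d => exact ⟨_, LinearMap.mulLeft k d, .nil, fun a => rfl⟩
    | cons x β d => exact ⟨_, LinearMap.mulLeft k d, .last x β, fun a => rfl⟩
  | last y β => exact ⟨_, LinearMap.id, .last (x.comp y) β, fun a => rfl⟩
  | step hf β b ih =>
    obtain ⟨g, c, hg, h⟩ := ih x
    exact ⟨_, c, .step hg β b, fun a => by simp only [APath.comp, h]⟩

theorem multilinRel_le_comap {i j i' j' : Γ} (F : APath A i j → APath A i' j')
    (hF : ∀ (v : Γ) (f : A v → APath A i j), IsSlot f →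
      ∃ (g : A v → APath A i' j') (c : A v →ₗ[k] A v), IsSlot g ∧ ∀ a, F (f a) = g (c a)) :
    multilinRel k A i j ≤ (multilinRel k A i' j').comap (Finsupp.lmapDomain k k F) := by
  refine Submodule.span_le.2 ?_
  rintro z (⟨v, f, a, b, hf, rfl⟩ | ⟨v, f, c, a, hf, rfl⟩)
  · obtain ⟨g, d, hg, h⟩ := hF v f hf
    refine Submodule.subset_span (Or.inl ⟨v, g, d a, d b, hg, ?_⟩)
    simp only [map_sub, map_add, Finsupp.lmapDomain_apply, Finsupp.mapDomain_single, h]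
  · obtain ⟨g, d, hg, h⟩ := hF v f hf
    refine Submodule.subset_span (Or.inr ⟨v, g, c, d a, hg, ?_⟩)
    simp only [Finsupp.lmapDomain_apply, map_sub, Finsupp.mapDomain_single, h, map_smul]

end APath

section GPA

variable (k : Type uk) [Field k] {Γ : Type uΓ} [Quiver.{vv} Γ] (A : Γ → Type va)
  [∀ i, Ring (A i)] [∀ i, Algebra k (A i)]

/-- The part of `k(Γ,𝒜)` spanned by the `𝒜`-paths from `i` to `j`: the vector space with basis
these `𝒜`-paths, modulo the multilinearity relations. -/
abbrev GPathHom (i j : Γ) : Type _ := (APath A i j →₀ k) ⧸ APath.multilinRel k A i j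

variable {A}

/-- The class of an `𝒜`-path. -/
def GPathHom.mk {i j : Γ} (x : APath A i j) : GPathHom k A i j :=
  (APath.multilinRel k A i j).mkQ (Finsupp.single x 1)

theorem GPathHom.induction {i j : Γ} {motive : GPathHom k A i j → Prop}
    (zero : motive 0) (add : ∀ f g, motive f → motive g → motive (f + g))
    (smul_mk : ∀ (c : k) (x : APath A i j), motive (c • GPathHom.mk k x))
    (f : GPathHom k A i j) : motive f := by
  obtain ⟨f, rfl⟩ := (APath.multilinRel k A i j).mkQ_surjective f
  induction f using Finsupp.induction_linear with
  | zero => rw [map_zero]; exact zero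
  | add f g hf hg => rw [map_add]; exact add _ _ hf hg
  | single x c =>
    have := smul_mk c x
    rwa [GPathHom.mk, ← map_smul, Finsupp.smul_single, smul_eq_mul, mul_one] at this

/-- Composition with the class of `x` on the left. -/
def GPathHom.compLeft {i j : Γ} (l : Γ) (x : APath A i j) :
    GPathHom k A j l →ₗ[k] GPathHom k A i l :=
  Submodule.mapQ (APath.multilinRel k A j l) (APath.multilinRel k A i l)
    (Finsupp.lmapDomain k k fun y : APath A j l => x.comp y)
    (APath.multilinRel_le_comap k _ fun _ _ hf => hf.comp_left k x)

theorem GPathHom.compLeft_mk {i j l : Γ} (x : APath A i j) (y : APath A j l) :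
    GPathHom.compLeft k l x (GPathHom.mk k y) = GPathHom.mk k (x.comp y) := by
  simp [GPathHom.compLeft, GPathHom.mk, Finsupp.mapDomain_single]

theorem GPathHom.compLeft_linearCombination {i j l : Γ} (z : APath A i j →₀ k)
    (y : APath A j l) :
    Finsupp.linearCombination k (GPathHom.compLeft k l) z (GPathHom.mk k y) =
      (APath.multilinRel k A i l).mkQ
        (Finsupp.lmapDomain k k (fun x : APath A i j => x.comp y) z) := by
  induction z using Finsupp.induction_linear with
  | zero => simp only [map_zero, LinearMap.zero_apply]
  | add f g hf hg => simp only [map_add, LinearMap.add_apply, hf, hg]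
  | single x a =>
    rw [Finsupp.linearCombination_single, LinearMap.smul_apply, GPathHom.compLeft_mk,
      Finsupp.lmapDomain_apply, Finsupp.mapDomain_single, GPathHom.mk, ← map_smul,
      Finsupp.smul_single, smul_eq_mul, mul_one]

/-- The composition of classes of `𝒜`-paths, extended bilinearly. -/
def GPathHom.comp {i j l : Γ} :
    GPathHom k A i j →ₗ[k] GPathHom k A j l →ₗ[k] GPathHom k A i l :=
  Submodule.liftQ (APath.multilinRel k A i j)
    (Finsupp.linearCombination k (GPathHom.compLeft k l))
    (by
      intro z hz
      rw [LinearMap.mem_ker]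
      refine LinearMap.ext fun g => ?_
      rw [LinearMap.zero_apply]
      induction g using GPathHom.induction k with
      | zero => rw [map_zero]
      | add f g hf hg => rw [map_add, hf, hg, add_zero]
      | smul_mk c y =>
        have h := APath.multilinRel_le_comap k (fun x : APath A i j => x.comp y)
            (fun _ _ hf => hf.comp_right k y) hz
        rw [map_smul, GPathHom.compLeft_linearCombination, Submodule.mkQ_apply,
          (Submodule.Quotient.mk_eq_zero _).2 (Submodule.mem_comap.1 h), smul_zero])

theorem GPathHom.comp_mk {i j l : Γ} (x : APath A i j) (y : APath A j l) :
    GPathHom.comp k (GPathHom.mk k x) (GPathHom.mk k y) = GPathHom.mk k (x.comp y) := by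
  rw [← GPathHom.compLeft_mk, GPathHom.comp, GPathHom.mk, Submodule.mkQ_apply,
    Submodule.liftQ_apply, Finsupp.linearCombination_single, one_smul]

variable (A) in
instance : LinComp k (GPathHom k A) where
  comp := GPathHom.comp k
  idn i := GPathHom.mk k (APath.nil 1)
  comp_assoc f g h := by
    induction f using GPathHom.induction k with
    | zero => simp
    | add f₁ f₂ h₁ h₂ => simp only [map_add, LinearMap.add_apply, h₁, h₂]
    | smul_mk a x =>
      induction g using GPathHom.induction k with
      | zero => simp
      | add f₁ f₂ h₁ h₂ => simp only [map_add, LinearMap.add_apply, h₁, h₂]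
      | smul_mk b y =>
        induction h using GPathHom.induction k with
        | zero => simp
        | add f₁ f₂ h₁ h₂ => simp only [map_add, h₁, h₂]
        | smul_mk c z =>
          simp only [map_smul, LinearMap.smul_apply, GPathHom.comp_mk, APath.comp_assoc]
  idn_comp f := by
    induction f using GPathHom.induction k with
    | zero => simp
    | add f₁ f₂ h₁ h₂ => simp only [map_add, h₁, h₂]
    | smul_mk a x => simp only [map_smul, GPathHom.comp_mk, APath.nil_one_comp]
  comp_idn f := by
    induction f using GPathHom.induction k with
    | zero => simp
    | add f₁ f₂ h₁ h₂ => simp only [map_add, LinearMap.add_apply, h₁, h₂]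
    | smul_mk a x =>
      simp only [map_smul, LinearMap.smul_apply, GPathHom.comp_mk, APath.comp_nil_one]

variable (A) in
/-- The generalized path algebra `k(Γ,𝒜)`. -/
def GPathAlgebra : Type _ := CompAlg k (GPathHom k A)

instance [Fintype Γ] : Ring (GPathAlgebra k A) := inferInstanceAs (Ring (CompAlg k (GPathHom k A)))

instance [Fintype Γ] : Algebra k (GPathAlgebra k A) :=
  inferInstanceAs (Algebra k (CompAlg k (GPathHom k A)))

/-- The inclusion of the part of `k(Γ,𝒜)` spanned by the `𝒜`-paths from `i` to `j`. -/
def GPathAlgebra.of [Fintype Γ] (i j : Γ) : GPathHom k A i j →ₗ[k] GPathAlgebra k A :=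
  CompAlg.of k (H := GPathHom k A) i j

/-- The class of an `𝒜`-path in `k(Γ,𝒜)`. -/
def GPathAlgebra.ofPath [Fintype Γ] {i j : Γ} (x : APath A i j) : GPathAlgebra k A :=
  GPathAlgebra.of k i j (GPathHom.mk k x)

theorem GPathAlgebra.of_mul_of [Fintype Γ] {i j l : Γ} (f : GPathHom k A i j)
    (g : GPathHom k A j l) :
    GPathAlgebra.of k i j f * GPathAlgebra.of k j l g =
      GPathAlgebra.of k i l (GPathHom.comp k f g) :=
  CompAlg.of_mul_of (k := k) (H := GPathHom k A) f g

theorem GPathAlgebra.ofPath_mul [Fintype Γ] {i j l : Γ} (x : APath A i j) (y : APath A j l) :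
    GPathAlgebra.ofPath k x * GPathAlgebra.ofPath k y = GPathAlgebra.ofPath k (x.comp y) := by
  unfold GPathAlgebra.ofPath
  rw [GPathAlgebra.of_mul_of, GPathHom.comp_mk]

theorem GPathHom.mk_slot_add {i j v : Γ} {f : A v → APath A i j} (hf : APath.IsSlot f)
    (a b : A v) : GPathHom.mk k (f (a + b)) = GPathHom.mk k (f a) + GPathHom.mk k (f b) := by
  unfold GPathHom.mk
  have h := (Submodule.Quotient.mk_eq_zero (APath.multilinRel k A i j)).2
    (Submodule.subset_span (Or.inl ⟨v, f, a, b, hf, rfl⟩))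
  rw [← Submodule.mkQ_apply, map_sub, map_add] at h
  exact sub_eq_zero.1 h

theorem GPathHom.mk_slot_smul {i j v : Γ} {f : A v → APath A i j} (hf : APath.IsSlot f)
    (c : k) (a : A v) : GPathHom.mk k (f (c • a)) = c • GPathHom.mk k (f a) := by
  unfold GPathHom.mk
  have h := (Submodule.Quotient.mk_eq_zero (APath.multilinRel k A i j)).2
    (Submodule.subset_span (Or.inr ⟨v, f, c, a, hf, rfl⟩))
  rw [← Submodule.mkQ_apply, map_sub, map_smul] at h
  exact sub_eq_zero.1 h

end GPA

/-! ## Generalized bound path algebras -/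

section GBP

variable {k : Type uk} [Field k] {Γ : Type uΓ} [Quiver.{vv} Γ] {A : Γ → Type va}
  [∀ i, Ring (A i)] [∀ i, Algebra k (A i)]

/-- `IsPreInsertion π p x`: for `p = β₁ ⋯ βₙ`, the `𝒜`-path `x` is `1 β₁ γ̄₁ β₂ γ̄₂ ⋯ βₙ γ̄ₙ` with paths
`γ_j` of the quiver presenting the algebra at the end of `β_j`. -/
inductive IsPreInsertion (π : ∀ i, QuiverPresentation.{uk, va, us, vs} k (A i)) :
    ∀ {i j : Γ}, Quiver.Path i j → APath A i j → Prop
  | nil {i : Γ} : IsPreInsertion π (Quiver.Path.nil : Quiver.Path i i) (APath.nil 1)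
  | cons {i j l : Γ} {p : Quiver.Path i j} {x : APath A i j} (h : IsPreInsertion π p x)
      (β : j ⟶ l) {u v : (π l).vertex} (σ : Quiver.Path u v) :
      IsPreInsertion π (p.cons β) (APath.cons x β ((π l).bar σ))

/-- `IsInsertion π p x`: for `p = β₁ ⋯ βₙ`, the `𝒜`-path `x` is `β₁ γ̄₁ β₂ γ̄₂ ⋯ γ̄ₙ₋₁ βₙ` (identities at
both ends) with paths `γ_j` of the quiver presenting the algebra at the end of `β_j`. -/
inductive IsInsertion (π : ∀ i, QuiverPresentation.{uk, va, us, vs} k (A i)) :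
    ∀ {i j : Γ}, Quiver.Path i j → APath A i j → Prop
  | nil {i : Γ} : IsInsertion π (Quiver.Path.nil : Quiver.Path i i) (APath.nil 1)
  | cons {i j l : Γ} {p : Quiver.Path i j} {x : APath A i j} (h : IsPreInsertion π p x)
      (β : j ⟶ l) : IsInsertion π (p.cons β) (APath.cons x β 1)

/-- A relation over `Γ`: a linear combination of paths with common start and common end. -/
abbrev QuiverRelation (k : Type uk) [Field k] (Γ : Type uΓ) [Quiver.{vv} Γ] : Type _ :=
  Σ i j : Γ, (Quiver.Path i j →₀ k)

/-- A relation as an element of `kΓ`. -/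
def QuiverRelation.toPathAlgebra (ρ : QuiverRelation k Γ) : PathAlgebra k Γ :=
  CompAlg.of k (H := PathHom k Γ) ρ.1 ρ.2.1 ρ.2.2

/-- The set `𝒜(I)`: in every relation of `I`, insert paths of the presenting quivers between
consecutive arrows, independently in every term of the relation. -/
def insertedRelations [Fintype Γ] (π : ∀ i, QuiverPresentation.{uk, va, us, vs} k (A i))
    (I : Set (QuiverRelation k Γ)) : Set (GPathAlgebra k A) :=
  {z | ∃ ρ ∈ I, ∃ x : Quiver.Path ρ.1 ρ.2.1 → APath A ρ.1 ρ.2.1,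
    (∀ p ∈ ρ.2.2.support, IsInsertion π p (x p)) ∧
      z = ρ.2.2.sum fun p c => c • GPathAlgebra.ofPath k (x p)}

variable [Fintype Γ]

/-- The generalized bound path algebra `Λ = k(Γ,𝒜,I) = k(Γ,𝒜)/(𝒜(I))`. -/
def GBPAlgebra (π : ∀ i, QuiverPresentation.{uk, va, us, vs} k (A i))
    (I : Set (QuiverRelation k Γ)) : Type _ :=
  (TwoSidedIdeal.span (insertedRelations π I)).ringCon.Quotient

namespace GBPAlgebra

variable (π : ∀ i, QuiverPresentation.{uk, va, us, vs} k (A i)) (I : Set (QuiverRelation k Γ))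

instance : Ring (GBPAlgebra π I) :=
  inferInstanceAs (Ring (TwoSidedIdeal.span (insertedRelations π I)).ringCon.Quotient)

instance : Algebra k (GBPAlgebra π I) :=
  inferInstanceAs (Algebra k (TwoSidedIdeal.span (insertedRelations π I)).ringCon.Quotient)

/-- The projection `k(Γ,𝒜) → Λ`. -/
def mk : GPathAlgebra k A →ₐ[k] GBPAlgebra π I :=
  { toFun := fun x => (x : (TwoSidedIdeal.span (insertedRelations π I)).ringCon.Quotient)
    map_one' := rfl
    map_mul' := fun _ _ => rfl
    map_zero' := rfl
    map_add' := fun _ _ => rfl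
    commutes' := fun _ => rfl }

theorem mk_surjective : Function.Surjective (mk π I) := fun x => Quotient.exists_rep x

theorem mk_eq_mk_iff (x y : GPathAlgebra k A) :
    mk π I x = mk π I y ↔ x - y ∈ TwoSidedIdeal.span (insertedRelations π I) :=
  (RingCon.eq (TwoSidedIdeal.span (insertedRelations π I)).ringCon).trans
    (TwoSidedIdeal.rel_iff _ _ _)

/-- The class of an `𝒜`-path in `Λ`. -/
def ofPath {i j : Γ} (x : APath A i j) : GBPAlgebra π I := mk π I (GPathAlgebra.ofPath k x)

/-- The class `ā` in `Λ` of an element `a` of `A_i`. -/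
def ofVertex (i : Γ) (a : A i) : GBPAlgebra π I := ofPath π I (APath.nil a)

/-- The class in `Λ` of an arrow. -/
def ofArrow {i j : Γ} (β : i ⟶ j) : GBPAlgebra π I :=
  ofPath π I (APath.cons (APath.nil 1) β 1)

theorem ofPath_mul {i j l : Γ} (x : APath A i j) (y : APath A j l) :
    ofPath π I x * ofPath π I y = ofPath π I (x.comp y) := by
  unfold ofPath
  rw [← map_mul, GPathAlgebra.ofPath_mul]

theorem ofVertex_mul (i : Γ) (a b : A i) :
    ofVertex π I i a * ofVertex π I i b = ofVertex π I i (a * b) :=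
  ofPath_mul π I _ _

theorem ofVertex_add (i : Γ) (a b : A i) :
    ofVertex π I i (a + b) = ofVertex π I i a + ofVertex π I i b := by
  unfold ofVertex ofPath GPathAlgebra.ofPath
  rw [GPathHom.mk_slot_add k APath.IsSlot.nil, map_add, map_add]

theorem ofVertex_smul (i : Γ) (c : k) (a : A i) :
    ofVertex π I i (c • a) = c • ofVertex π I i a := by
  unfold ofVertex ofPath GPathAlgebra.ofPath
  rw [GPathHom.mk_slot_smul k APath.IsSlot.nil, map_smul, map_smul]

theorem ofPath_cons {i j l : Γ} (x : APath A i j) (β : j ⟶ l) (a : A l) :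
    ofPath π I (APath.cons x β a) = ofPath π I x * ofArrow π I β * ofVertex π I l a := by
  unfold ofArrow ofVertex
  rw [ofPath_mul, ofPath_mul]
  congr 1
  cases x <;> simp [APath.comp, APath.mulLast]

theorem ofArrow_mul_ofVertex_one {i j : Γ} (β : i ⟶ j) :
    ofArrow π I β * ofVertex π I j 1 = ofArrow π I β := by
  unfold ofArrow ofVertex
  rw [ofPath_mul, APath.comp_nil_one]

theorem relation_eq_zero {ρ : QuiverRelation k Γ} (hρ : ρ ∈ I)
    (x : Quiver.Path ρ.1 ρ.2.1 → APath A ρ.1 ρ.2.1)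
    (hx : ∀ p ∈ ρ.2.2.support, IsInsertion π p (x p)) :
    (ρ.2.2.sum fun p c => c • ofPath π I (x p)) = 0 := by
  have h : mk π I (ρ.2.2.sum fun p c => c • GPathAlgebra.ofPath k (x p)) = mk π I 0 := by
    rw [mk_eq_mk_iff, sub_zero]
    exact TwoSidedIdeal.subset_span ⟨ρ, hρ, x, hx, rfl⟩
  rw [map_zero, Finsupp.sum, map_sum] at h
  rw [← h, Finsupp.sum]
  exact Finset.sum_congr rfl fun p _ => (map_smul (mk π I) _ _).symm

end GBPAlgebra

end GBP

/-! ## Representations -/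

section Rep

variable {k : Type uk} [Field k] {Γ : Type uΓ} [Quiver.{vv} Γ] {A : Γ → Type va}
  [∀ i, Ring (A i)] [∀ i, Algebra k (A i)]

/-- The linear map `M_i → M_j` defined by an `𝒜`-path from `i` to `j`: the composite of the maps of
its arrows and of the right multiplications by its entries, in the order in which they occur. -/
def APath.act {M : Γ → Type w} [∀ i, AddCommGroup (M i)] [∀ i, Module k (M i)]
    [∀ i, Module (A i)ᵐᵒᵖ (M i)] [∀ i, IsScalarTower k (A i)ᵐᵒᵖ (M i)]
    (φ : ∀ {i j : Γ}, (i ⟶ j) → (M i →ₗ[k] M j)) : ∀ {i j : Γ}, APath A i j → (M i →ₗ[k] M j)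
  | i, _, .nil a => Algebra.lsmul k k (M i) (op a)
  | _, j, .cons x β a => Algebra.lsmul k k (M j) (op a) ∘ₗ φ β ∘ₗ APath.act φ x

/-- Representations of `k(Γ,𝒜,I)`; right `A_i`-modules are modules over `(A_i)ᵐᵒᵖ`. -/
structure GRep (π : ∀ i, QuiverPresentation.{uk, va, us, vs} k (A i))
    (I : Set (QuiverRelation k Γ)) where
  obj : Γ → Type w
  [addCommGroup : ∀ i, AddCommGroup (obj i)]
  [module : ∀ i, Module k (obj i)]
  [rightModule : ∀ i, Module (A i)ᵐᵒᵖ (obj i)]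
  [isScalarTower : ∀ i, IsScalarTower k (A i)ᵐᵒᵖ (obj i)]
  map : ∀ {i j : Γ}, (i ⟶ j) → (obj i →ₗ[k] obj j)
  satisfies : ∀ ρ ∈ I, ∀ x : Quiver.Path ρ.1 ρ.2.1 → APath A ρ.1 ρ.2.1,
    (∀ p ∈ ρ.2.2.support, IsInsertion π p (x p)) →
      (ρ.2.2.sum fun p c => c • APath.act map (x p)) = 0

attribute [instance] GRep.addCommGroup GRep.module GRep.rightModule GRep.isScalarTower

namespace GRep

variable {π : ∀ i, QuiverPresentation.{uk, va, us, vs} k (A i)} {I : Set (QuiverRelation k Γ)}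

/-- Morphisms of representations. -/
@[ext] structure Hom (M : GRep.{uk, uΓ, va, vv, us, vs, w} π I)
    (N : GRep.{uk, uΓ, va, vv, us, vs, w'} π I) where
  app : ∀ i, M.obj i →ₗ[(A i)ᵐᵒᵖ] N.obj i
  comm : ∀ {i j : Γ} (β : i ⟶ j) (m : M.obj i), app j (M.map β m) = N.map β (app i m)

/-- Isomorphisms of representations. -/
structure Iso (M : GRep.{uk, uΓ, va, vv, us, vs, w} π I)
    (N : GRep.{uk, uΓ, va, vv, us, vs, w'} π I) where
  app : ∀ i, M.obj i ≃ₗ[(A i)ᵐᵒᵖ] N.obj i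
  comm : ∀ {i j : Γ} (β : i ⟶ j) (m : M.obj i), app j (M.map β m) = N.map β (app i m)

/-- The morphism underlying an isomorphism. -/
def Iso.hom {M : GRep.{uk, uΓ, va, vv, us, vs, w} π I}
    {N : GRep.{uk, uΓ, va, vv, us, vs, w'} π I} (f : Iso M N) : Hom M N where
  app i := (f.app i).toLinearMap
  comm β m := f.comm β m

/-- Composition: first `f`, then `g`. -/
def Hom.comp {M N L : GRep.{uk, uΓ, va, vv, us, vs, w} π I} (f : Hom M N) (g : Hom N L) :
    Hom M L where
  app i := g.app i ∘ₗ f.app i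
  comm β m := by simp [f.comm, g.comm]

/-- Subrepresentations: families of `A_i`-submodules stable under the maps of the arrows. -/
structure Sub (M : GRep.{uk, uΓ, va, vv, us, vs, w} π I) where
  carrier : ∀ i, Submodule (A i)ᵐᵒᵖ (M.obj i)
  stable : ∀ {i j : Γ} (β : i ⟶ j) (m : M.obj i), m ∈ carrier i → M.map β m ∈ carrier j

variable {M : GRep.{uk, uΓ, va, vv, us, vs, w} π I}

/-- The restriction of the map of an arrow to a subrepresentation. -/
def Sub.map (N : Sub M) {i j : Γ} (β : i ⟶ j) : N.carrier i →ₗ[k] N.carrier j where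
  toFun m := ⟨M.map β m, N.stable β m m.2⟩
  map_add' m n := Subtype.ext (by simp)
  map_smul' c m := Subtype.ext (by simp)

theorem Sub.coe_act (N : Sub M) {i j : Γ} (x : APath A i j) (m : N.carrier i) :
    ((APath.act (M := fun i => N.carrier i) N.map x m : N.carrier j) : M.obj j) =
      APath.act M.map x m := by
  induction x with
  | nil a => simp [APath.act]
  | cons x β a ih => simp [APath.act, Sub.map, ih]

/-- A subrepresentation as a representation, with the restricted maps. -/
def Sub.toRep (N : Sub M) : GRep.{uk, uΓ, va, vv, us, vs, w} π I where
  obj i := N.carrier i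
  map β := N.map β
  satisfies ρ hρ x hx := by
    refine LinearMap.ext fun m => Subtype.ext ?_
    have h := LinearMap.congr_fun (M.satisfies ρ hρ x hx) (m : M.obj ρ.1)
    simp only [Finsupp.sum, LinearMap.sum_apply, LinearMap.smul_apply, LinearMap.zero_apply,
      AddSubmonoidClass.coe_finsetSum, ZeroMemClass.coe_zero] at h ⊢
    rw [← h]
    refine Finset.sum_congr rfl fun p _ => ?_
    rw [← N.coe_act]
    rfl

/-- The inclusion of a subrepresentation. -/
def Sub.incl (N : Sub M) : Hom N.toRep M where
  app i := (N.carrier i).subtype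
  comm _ _ := rfl

end GRep

/-! ## The representation of a module -/

variable [Fintype Γ]
variable (π : ∀ i, QuiverPresentation.{uk, va, us, vs} k (A i)) (I : Set (QuiverRelation k Γ))

section

variable (X : Type w) [AddCommGroup X] [Module k X] [Module (GBPAlgebra π I)ᵐᵒᵖ X]
  [IsScalarTower k (GBPAlgebra π I)ᵐᵒᵖ X]

/-- The subspace `X · 1_i` of a right `Λ`-module `X`. -/
def vertexSpace (i : Γ) : Submodule k X :=
  LinearMap.range (Algebra.lsmul k k X (op (GBPAlgebra.ofVertex π I i 1)))

variable {X}

theorem vertexSpace.smul_mem {i : Γ} {y : GBPAlgebra π I}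
    (hy : y * GBPAlgebra.ofVertex π I i 1 = y) (x : X) : op y • x ∈ vertexSpace π I X i :=
  ⟨op y • x, by
    change op (GBPAlgebra.ofVertex π I i 1) • op y • x = op y • x
    rw [smul_smul, ← op_mul, hy]⟩

theorem vertexSpace.smul_one {i : Γ} {x : X} (hx : x ∈ vertexSpace π I X i) :
    op (GBPAlgebra.ofVertex π I i 1) • x = x := by
  obtain ⟨y, rfl⟩ := hx
  change op (GBPAlgebra.ofVertex π I i 1) • op (GBPAlgebra.ofVertex π I i 1) • y =
    op (GBPAlgebra.ofVertex π I i 1) • y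
  rw [smul_smul, ← op_mul, GBPAlgebra.ofVertex_mul, one_mul]

variable (X)

/-- The right `A_i`-module structure of `X · 1_i`, `x · a = x · ā`. -/
instance vertexSpace.rightModule (i : Γ) : Module (A i)ᵐᵒᵖ (vertexSpace π I X i) where
  smul a x := ⟨op (GBPAlgebra.ofVertex π I i a.unop) • (x : X),
    vertexSpace.smul_mem π I (by rw [GBPAlgebra.ofVertex_mul, mul_one]) _⟩
  one_smul x := Subtype.ext (vertexSpace.smul_one π I x.2)
  mul_smul a b x := Subtype.ext (by
    change op (GBPAlgebra.ofVertex π I i (b.unop * a.unop)) • (x : X) =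
      op (GBPAlgebra.ofVertex π I i a.unop) • op (GBPAlgebra.ofVertex π I i b.unop) • (x : X)
    rw [smul_smul, ← op_mul, GBPAlgebra.ofVertex_mul])
  smul_zero a := Subtype.ext (smul_zero _)
  smul_add a x y := Subtype.ext (smul_add _ _ _)
  add_smul a b x := Subtype.ext (by
    change op (GBPAlgebra.ofVertex π I i (a.unop + b.unop)) • (x : X) =
      op (GBPAlgebra.ofVertex π I i a.unop) • (x : X) +
        op (GBPAlgebra.ofVertex π I i b.unop) • (x : X)
    rw [GBPAlgebra.ofVertex_add, op_add, add_smul])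
  zero_smul x := Subtype.ext (by
    change op (GBPAlgebra.ofVertex π I i 0) • (x : X) = 0
    have h := GBPAlgebra.ofVertex_smul π I i (0 : k) 0
    rw [zero_smul, zero_smul] at h
    rw [h, op_zero, zero_smul])

theorem vertexSpace.coe_smul (i : Γ) (a : A i) (x : vertexSpace π I X i) :
    ((op a • x : vertexSpace π I X i) : X) = op (GBPAlgebra.ofVertex π I i a) • (x : X) := rfl

instance vertexSpace.isScalarTower (i : Γ) :
    IsScalarTower k (A i)ᵐᵒᵖ (vertexSpace π I X i) where
  smul_assoc c a x := Subtype.ext (by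
    change op (GBPAlgebra.ofVertex π I i (c • a.unop)) • (x : X) =
      c • (op (GBPAlgebra.ofVertex π I i a.unop) • (x : X))
    rw [GBPAlgebra.ofVertex_smul, op_smul, smul_assoc])

/-- The map `X · 1_i → X · 1_j`, `x ↦ x · β`, of an arrow `β : i → j`. -/
def vertexSpace.map {i j : Γ} (β : i ⟶ j) : vertexSpace π I X i →ₗ[k] vertexSpace π I X j :=
  LinearMap.codRestrict (vertexSpace π I X j)
    (Algebra.lsmul k k X (op (GBPAlgebra.ofArrow π I β)) ∘ₗ (vertexSpace π I X i).subtype)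
    (fun x => vertexSpace.smul_mem π I (GBPAlgebra.ofArrow_mul_ofVertex_one π I β) (x : X))

theorem vertexSpace.coe_act {i j : Γ} (x : APath A i j) (m : vertexSpace π I X i) :
    ((APath.act (M := fun i => vertexSpace π I X i) (vertexSpace.map π I X) x m :
      vertexSpace π I X j) : X) = op (GBPAlgebra.ofPath π I x) • (m : X) := by
  induction x with
  | nil a => rw [APath.act]; rfl
  | cons x β a ih =>
    have h := ih
    rw [GBPAlgebra.ofPath_cons, op_mul, op_mul, mul_smul, mul_smul, ← h, APath.act]
    rfl

/-- The representation associated to a right `Λ`-module `X`: the `A_i`-modules `X · 1_i` with the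
maps `x ↦ x · β`. -/
def GRep.ofModule : GRep.{uk, uΓ, va, vv, us, vs, w} π I where
  obj i := vertexSpace π I X i
  map β := vertexSpace.map π I X β
  satisfies ρ hρ x hx := by
    refine LinearMap.ext fun m => Subtype.ext ?_
    have h := GBPAlgebra.relation_eq_zero π I hρ x hx
    simp only [Finsupp.sum, LinearMap.sum_apply, LinearMap.smul_apply, LinearMap.zero_apply,
      AddSubmonoidClass.coe_finsetSum, Submodule.coe_smul, ZeroMemClass.coe_zero,
      vertexSpace.coe_act] at h ⊢
    have h' := congrArg (fun y => op y • (m : X)) h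
    simpa only [op_zero, zero_smul, Finset.op_sum, Finset.sum_smul, op_smul, smul_assoc] using h'

end

/-- The morphism of representations associated to a homomorphism of right `Λ`-modules, given by
restriction. -/
def GRep.mapModule {X Y : Type w} [AddCommGroup X] [Module k X] [Module (GBPAlgebra π I)ᵐᵒᵖ X]
    [IsScalarTower k (GBPAlgebra π I)ᵐᵒᵖ X] [AddCommGroup Y] [Module k Y]
    [Module (GBPAlgebra π I)ᵐᵒᵖ Y] [IsScalarTower k (GBPAlgebra π I)ᵐᵒᵖ Y]
    (g : X →ₗ[(GBPAlgebra π I)ᵐᵒᵖ] Y) : Hom (GRep.ofModule π I X) (GRep.ofModule π I Y) where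
  app i :=
    { toFun := fun x => (⟨g (x : vertexSpace π I X i).1, by
          rw [← vertexSpace.smul_one π I x.2, map_smul]
          exact vertexSpace.smul_mem π I (by rw [GBPAlgebra.ofVertex_mul, mul_one]) _⟩ :
            vertexSpace π I Y i)
      map_add' := fun x y => Subtype.ext (map_add g _ _)
      map_smul' := fun a x => Subtype.ext (map_smul g _ _) }
  comm β m := Subtype.ext (map_smul g _ _)

end Rep

/-! ## Idempotents and projectives -/

/-- Primitive idempotents: nonzero idempotents that are not the sum of two nonzero orthogonal
idempotents. -/
def IsPrimitiveIdempotent {R : Type*} [Ring R] (e : R) : Prop :=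
  IsIdempotentElem e ∧ e ≠ 0 ∧ ∀ f g : R, IsIdempotentElem f → IsIdempotentElem g →
    f * g = 0 → g * f = 0 → e = f + g → f = 0 ∨ g = 0

/-- The right ideal `e R`. -/
abbrev rightIdeal {R : Type*} [Ring R] (e : R) : Submodule Rᵐᵒᵖ R := Submodule.span Rᵐᵒᵖ {e}

/-- The radical of a right module: the intersection of its maximal submodules. -/
abbrev rightRad (R : Type*) [Ring R] (X : Type*) [AddCommGroup X] [Module Rᵐᵒᵖ X] :
    Submodule Rᵐᵒᵖ X := Module.jacobson Rᵐᵒᵖ X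

end

noncomputable section

open MulOpposite

/-! Write `τ` for the map `Λ → A_i` that reads off the length-zero part at `i`, and `e` for the
chosen idempotent of `A_i`. On `k(Γ,𝒜)` this map is multiplicative, since a product of `𝒜`-paths has
length zero only if both factors do. It kills the inserted relations: the relations in `I` lie in
`R²`, so only paths of positive length occur in them. Hence `τ` descends to `Λ`, and it is a left
inverse of `a ↦ ā`. As `Γ` has no oriented cycles, every `𝒜`-path from `i` to `i` has length zero,
so `1_i y 1_i` is the class of `τ(y)` for all `y` in `Λ`; that is, `1_i Λ 1_i` is a copy of `A_i`
(`GBPAlgebra.ofVertex_one_mul_mul_ofVertex_one`).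

Restricting `τ` gives a surjection `ēΛ → eA_i`, semilinear over `τ` (`projTop`). Its kernel lies in
the radical: if `τ(x) = 0`, then `x c ē = 0` for every `c`, so in an equation `ē = κ + x c` right
multiplication by `ē` removes the second term, and a maximal submodule not containing `x` would
contain the generator `ē` (`ker_projTop_le`). A surjection whose kernel lies in the radical pulls
radical back to radical, so `rad ēΛ` is the preimage of `rad eA_i` (`mem_rightRad_iff`).

It remains to look at this preimage vertex by vertex. On `ēΛ · 1_i` the map is the inverse of `x ↦
x̄`, which gives `rad P_i^j`. On `ēΛ · 1_l` with `l ≠ i` it vanishes because `τ(1_l) = 0`, so the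
whole space lies in the radical. -/

/-! ### Length-zero parts in the generalized path algebra. -/

/-- The entry of an `𝒜`-path of length zero; zero for `𝒜`-paths of positive length. -/
def APath.nilPart {Γ : Type uΓ} [Quiver.{vv} Γ] {A : Γ → Type va} [∀ i, Ring (A i)] {i : Γ} :
    ∀ {j : Γ}, APath A i j → A i
  | _, .nil a => a
  | _, .cons _ _ _ => 0

section

variable {k : Type uk} [Field k] {Γ : Type uΓ} [Quiver.{vv} Γ] {A : Γ → Type va}
  [∀ i, Ring (A i)] [∀ i, Algebra k (A i)]

/-- The projection of `1_i k(Γ,𝒜) 1_j` onto the part of length zero. -/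
def GPathHom.nilPart (i j : Γ) : GPathHom k A i j →ₗ[k] A i :=
  Submodule.liftQ (APath.multilinRel k A i j)
    (Finsupp.linearCombination k (APath.nilPart : APath A i j → A i))
    (by
      refine Submodule.span_le.2 ?_
      -- Only the slot of a length-zero `𝒜`-path is visible to `nilPart`, which returns the inserted
      -- entry there; the other slots give positive length, hence zero in every term.
      rintro z (⟨v, f, a, b, hf, rfl⟩ | ⟨v, f, c, a, hf, rfl⟩) <;>
      cases hf <;> simp [APath.nilPart])

theorem GPathHom.nilPart_mk {i j : Γ} (x : APath A i j) :
    GPathHom.nilPart i j (GPathHom.mk k x) = x.nilPart := by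
  change Finsupp.linearCombination k (APath.nilPart : APath A i j → A i) (Finsupp.single x 1) = _
  rw [Finsupp.linearCombination_single, one_smul]

/-- Lengths add under composition: if one factor has positive length, both sides vanish, and two
factors of length zero compose by multiplying their entries. -/
theorem GPathHom.nilPart_comp_self {i : Γ} (f g : GPathHom k A i i) :
    GPathHom.nilPart i i (GPathHom.comp k f g) =
      GPathHom.nilPart i i f * GPathHom.nilPart i i g := by
  induction f using GPathHom.induction k with
  | zero => simp
  | add f₁ f₂ h₁ h₂ => simp only [map_add, LinearMap.add_apply, h₁, h₂, add_mul]
  | smul_mk a x =>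
    induction g using GPathHom.induction k with
    | zero => simp
    | add f₁ f₂ h₁ h₂ => simp only [map_add, h₁, h₂, mul_add]
    | smul_mk b y =>
      simp only [map_smul, LinearMap.smul_apply, GPathHom.comp_mk, GPathHom.nilPart_mk]
      have h : (x.comp y).nilPart = x.nilPart * y.nilPart := by
        cases y with
        | nil b => cases x <;> simp [APath.comp, APath.mulLast, APath.nilPart]
        | cons y β b => simp [APath.comp, APath.nilPart]
      rw [h, smul_mul_assoc, mul_smul_comm, smul_comm]

/-- An `𝒜`-path between distinct vertices has positive length, and so does everything it is composed
with. -/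
theorem GPathHom.nilPart_comp_of_ne {i j : Γ} (hij : i ≠ j) (f : GPathHom k A i j)
    (g : GPathHom k A j i) : GPathHom.nilPart i i (GPathHom.comp k f g) = 0 := by
  induction f using GPathHom.induction k with
  | zero => simp
  | add f₁ f₂ h₁ h₂ => simp only [map_add, LinearMap.add_apply, h₁, h₂, add_zero]
  | smul_mk a x =>
    induction g using GPathHom.induction k with
    | zero => simp
    | add f₁ f₂ h₁ h₂ => simp only [map_add, h₁, h₂, add_zero]
    | smul_mk b y =>
      simp only [map_smul, LinearMap.smul_apply, GPathHom.comp_mk, GPathHom.nilPart_mk]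
      have h : (x.comp y).nilPart = 0 := by
        cases y with
        | nil b => exact absurd rfl hij
        | cons y β b => rfl
      rw [h, smul_zero, smul_zero]

variable [Fintype Γ]

/-- The algebra homomorphism `k(Γ,𝒜) → A_i` that annihilates the `𝒜`-paths other than those of
length zero at `i`. -/
def GPathAlgebra.toVertex (k : Type uk) [Field k] {Γ : Type uΓ} [Quiver.{vv} Γ] [Fintype Γ]
    {A : Γ → Type va} [∀ i, Ring (A i)] [∀ i, Algebra k (A i)] (i : Γ) :
    GPathAlgebra k A →ₐ[k] A i :=
  AlgHom.ofLinearMap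
    { toFun := fun f => GPathHom.nilPart i i (f i i)
      map_add' := fun f g => map_add (GPathHom.nilPart i i) (f i i) (g i i)
      map_smul' := fun c f => map_smul (GPathHom.nilPart i i) c (f i i) }
    (by
      classical
      change GPathHom.nilPart i i ((1 : CompAlg k (GPathHom k A)) i i) = 1
      rw [CompAlg.one_apply, Pi.single_eq_same]
      exact GPathHom.nilPart_mk _)
    (fun f g => by
      change GPathHom.nilPart i i (CompAlg.instMul.mul f g i i) = _
      change GPathHom.nilPart i i (∑ j, GPathHom.comp k (f i j) (g j i)) =
        GPathHom.nilPart i i (f i i) * GPathHom.nilPart i i (g i i)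
      -- The `(i,i)` entry of a product is a sum over intermediate vertices; those other than `i`
      -- contribute only positive length.
      rw [map_sum, Finset.sum_eq_single i]
      · exact GPathHom.nilPart_comp_self _ _
      · exact fun j _ hj => GPathHom.nilPart_comp_of_ne hj.symm _ _
      · simp)

theorem GPathAlgebra.toVertex_ofPath {i j : Γ} (x : APath A i j) :
    GPathAlgebra.toVertex k i (GPathAlgebra.ofPath k x) = x.nilPart := by
  change GPathHom.nilPart i i (CompAlg.of k (H := GPathHom k A) i j (GPathHom.mk k x) i i) = _
  by_cases h : i = j
  · subst h
    rw [CompAlg.of_same, GPathHom.nilPart_mk]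
  · rw [CompAlg.of_ne_right _ h, map_zero]
    cases x with
    | nil a => exact absurd rfl h
    | cons x β a => rfl

theorem GPathAlgebra.toVertex_ofPath_of_ne {v i j : Γ} (h : v ≠ i) (x : APath A i j) :
    GPathAlgebra.toVertex k v (GPathAlgebra.ofPath k x) = 0 := by
  change GPathHom.nilPart v v (CompAlg.of k (H := GPathHom k A) i j (GPathHom.mk k x) v v) = _
  rw [CompAlg.of_ne_left _ h, map_zero]

/-! ### Relations in an admissible ideal involve no trivial paths. -/

/-- The coefficient of the trivial path at `i` of an element of `kQ`. -/
def PathAlgebra.nilCoeff (k : Type*) [Field k] {Q : Type*} [Quiver Q] [Fintype Q] (i : Q) :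
    PathAlgebra k Q →ₗ[k] k where
  toFun f := (f i i : Quiver.Path i i →₀ k) Quiver.Path.nil
  map_add' _ _ := rfl
  map_smul' _ _ := rfl

/-- A concatenation is trivial only if both pieces are, so a single pair of coefficients contributes
to the trivial path of the product. -/
theorem PathAlgebra.nilCoeff_mul (k : Type*) [Field k] {Q : Type*} [Quiver Q] [Fintype Q] (i : Q)
    (f g : PathAlgebra k Q) : nilCoeff k i (f * g) = nilCoeff k i f * nilCoeff k i g := by
  classical
  -- The contribution of one intermediate vertex `j`. A trivial path from `i` to `j` exists only
  -- when `j = i`; the transports along `h` express this.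
  have key : ∀ (j : Q) (f : Quiver.Path i j →₀ k) (g : Quiver.Path j i →₀ k)
      (a : Quiver.Path i i →₀ k) (_ : a = PathHom.comp k f g),
      a Quiver.Path.nil = if h : j = i then f (h ▸ Quiver.Path.nil) * g (h ▸ Quiver.Path.nil)
        else 0 := by
    rintro j f g _ rfl
    induction f using Finsupp.induction_linear with
    | zero => simp
    | add f₁ f₂ h₁ h₂ =>
      rw [map_add, LinearMap.add_apply, Finsupp.add_apply, h₁, h₂]
      split_ifs <;> simp [add_mul]
    | single p a =>
      induction g using Finsupp.induction_linear with
      | zero => simp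
      | add f₁ f₂ h₁ h₂ =>
        rw [map_add, Finsupp.add_apply, h₁, h₂]
        split_ifs <;> simp [mul_add]
      | single q b =>
        rw [PathHom.comp_single]
        cases q with
        | cons q β =>
          split_ifs with h
          · subst h
            simp
          · simp
        | nil =>
          cases p <;> simp
  change ((∑ j, PathHom.comp k (f i j) (g j i) : Quiver.Path i i →₀ k)) Quiver.Path.nil = _
  rw [Finsupp.finsetSum_apply, Finset.sum_eq_single i]
  · rw [key i _ _ _ rfl, dif_pos rfl]
    rfl
  · intro j _ hj
    rw [key j _ _ _ rfl, dif_neg hj]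
  · simp

theorem PathAlgebra.nilCoeff_eq_zero_of_mem_lengthIdeal {k : Type*} [Field k] {Q : Type*}
    [Quiver Q] [Fintype Q] {n : ℕ} (hn : 0 < n) (i : Q) {f : PathAlgebra k Q}
    (hf : f ∈ lengthIdeal k Q n) : nilCoeff k i f = 0 := by
  -- Multiplicativity makes the kernel of `nilCoeff` a two-sided ideal, so it suffices to test the
  -- generating paths of `lengthIdeal`.
  let K : TwoSidedIdeal (PathAlgebra k Q) :=
    TwoSidedIdeal.mk' {f | nilCoeff k i f = 0} (map_zero _)
      (fun {x y} hx hy => by simp_all) (fun {x} hx => by simp_all)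
      (fun {x y} hy => by simp_all [nilCoeff_mul]) (fun {x y} hx => by simp_all [nilCoeff_mul])
  have hK : ∀ x, x ∈ K ↔ nilCoeff k i x = 0 := fun x => by simp [K]
  have h : lengthIdeal k Q n ≤ K := by
    refine TwoSidedIdeal.span_le.2 ?_
    rintro x ⟨a, b, p, hp, rfl⟩
    refine (hK _).2 ?_
    change (CompAlg.of k (H := PathHom k Q) a b (Finsupp.single p (1 : k)) i i :
      Quiver.Path i i →₀ k) Quiver.Path.nil = 0
    by_cases ha : i = a
    · subst ha
      by_cases hb : i = b
      · subst hb
        rw [CompAlg.of_same]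
        refine Finsupp.single_eq_of_ne ?_
        rintro rfl
        simp at hp
        omega
      · rw [CompAlg.of_ne_right _ hb]; rfl
    · rw [CompAlg.of_ne_left _ ha]; rfl
  exact (hK f).1 (h hf)

/-- Elements of `R²` have zero coefficient at every trivial path, whereas a trivial path in the
support would be a nonzero one. -/
theorem QuiverRelation.length_pos_of_mem_support {I : Set (QuiverRelation k Γ)}
    (admissible : PathAlgebra.IsAdmissible
      (TwoSidedIdeal.span (QuiverRelation.toPathAlgebra '' I)))
    {ρ : QuiverRelation k Γ} (hρ : ρ ∈ I) {p : Quiver.Path ρ.1 ρ.2.1}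
    (hp : p ∈ ρ.2.2.support) : 0 < p.length := by
  have h : ρ.toPathAlgebra ∈ PathAlgebra.lengthIdeal k Γ 2 :=
    admissible.1 (TwoSidedIdeal.subset_span ⟨ρ, hρ, rfl⟩)
  obtain ⟨i, j, r⟩ := ρ
  change Quiver.Path i j at p
  cases p with
  | cons p β => simp
  | nil =>
    have h0 := PathAlgebra.nilCoeff_eq_zero_of_mem_lengthIdeal two_pos i h
    change (CompAlg.of k (H := PathHom k Γ) i i r i i : Quiver.Path i i →₀ k)
      Quiver.Path.nil = 0 at h0
    rw [CompAlg.of_same] at h0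
    exact absurd h0 (Finsupp.mem_support_iff.1 hp)

/-! ### The corner at a vertex. -/

/-- Multiplication in `CompAlg` is matrix multiplication, and the local identity is a diagonal
matrix unit. -/
theorem CompAlg.idn_mul_mul_idn {k : Type*} [Field k] {V : Type*} {H : V → V → Type*}
    [∀ i j, AddCommGroup (H i j)] [∀ i j, Module k (H i j)] [Fintype V] [LinComp k H] (i : V)
    (f : CompAlg k H) :
    CompAlg.of k i i (LinComp.idn (k := k) i) * f * CompAlg.of k i i (LinComp.idn (k := k) i) =
      CompAlg.of k i i (f i i) := by
  ext a b
  rw [CompAlg.mul_apply, Finset.sum_eq_single i]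
  · rw [CompAlg.mul_apply, Finset.sum_eq_single i]
    · by_cases ha : a = i
      · subst ha
        by_cases hb : b = a
        · subst hb
          simp only [CompAlg.of_same, LinComp.idn_comp, LinComp.comp_idn]
        · rw [CompAlg.of_ne_right _ hb, CompAlg.of_ne_right _ hb, map_zero]
      · simp only [CompAlg.of_ne_left _ ha, map_zero, LinearMap.zero_apply]
    · intro c _ hc
      by_cases ha : a = i
      · subst ha
        rw [CompAlg.of_ne_right _ hc, map_zero, LinearMap.zero_apply]
      · rw [CompAlg.of_ne_left _ ha, map_zero, LinearMap.zero_apply]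
    · simp
  · intro c _ hc
    rw [CompAlg.of_ne_left _ hc, map_zero]
  · simp

theorem GPathAlgebra.ofVertex_mul_mul_ofVertex (i : Γ) (f : GPathAlgebra k A) :
    GPathAlgebra.ofPath k (APath.nil (1 : A i)) * f * GPathAlgebra.ofPath k (APath.nil (1 : A i)) =
      GPathAlgebra.of k i i (f i i) :=
  CompAlg.idn_mul_mul_idn (k := k) (H := GPathHom k A) i f

/-- Forgetting the entries turns an `𝒜`-path into a path of `Γ` of the same shape; positive length
would produce an oriented cycle. -/
theorem APath.exists_eq_nil (acyclic : ∀ (i : Γ) (p : Quiver.Path i i), p.length = 0)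
    {i : Γ} (x : APath A i i) : ∃ a, x = APath.nil a := by
  have path : ∀ {j : Γ}, APath A i j → Nonempty (Quiver.Path i j) := by
    intro j y
    induction y with
    | nil a => exact ⟨.nil⟩
    | cons y β a ih => exact ⟨ih.some.cons β⟩
  cases x with
  | nil a => exact ⟨a, rfl⟩
  | cons y β a =>
    have := acyclic i ((path y).some.cons β)
    simp at this

/-! ### The projection from `Λ` to a vertex algebra. -/

namespace GBPAlgebra

variable {π : ∀ i, QuiverPresentation.{uk, va, us, vs} k (A i)} {I : Set (QuiverRelation k Γ)}

/-- This is what lets the projection descend to `Λ`: inserting entries into a path of positive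
length gives an `𝒜`-path of positive length, so every term of an inserted relation is killed
separately. -/
theorem toVertex_eq_zero_of_mem_span
    (admissible : PathAlgebra.IsAdmissible
      (TwoSidedIdeal.span (QuiverRelation.toPathAlgebra '' I))) (i : Γ) {z : GPathAlgebra k A}
    (hz : z ∈ TwoSidedIdeal.span (insertedRelations π I)) :
    GPathAlgebra.toVertex k i z = 0 := by
  have h : TwoSidedIdeal.span (insertedRelations π I) ≤
      TwoSidedIdeal.ker (GPathAlgebra.toVertex k (A := A) i) := by
    refine TwoSidedIdeal.span_le.2 ?_
    rintro z ⟨⟨i', j', r⟩, hρ, x, hx, rfl⟩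
    refine (TwoSidedIdeal.mem_ker _).2 ?_
    rw [Finsupp.sum, map_sum]
    refine Finset.sum_eq_zero fun p hp => ?_
    rw [map_smul]
    have hlen := QuiverRelation.length_pos_of_mem_support admissible hρ hp
    by_cases hi : i = i'
    · subst hi
      rw [GPathAlgebra.toVertex_ofPath]
      have hins := hx p hp
      dsimp only at p x hins ⊢
      -- An insertion into a trivial path is excluded by `hlen`; any other ends in an arrow and has
      -- no length-zero part.
      generalize x p = y at hins
      cases hins with
      | nil => simp at hlen
      | cons h β => exact smul_zero _
    · rw [GPathAlgebra.toVertex_ofPath_of_ne hi, smul_zero]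
  exact (TwoSidedIdeal.mem_ker _).1 (h hz)

/-- The homomorphism `Λ → A_i` that annihilates the classes of all `𝒜`-paths but those of length
zero at `i`. -/
def toVertex (π : ∀ i, QuiverPresentation.{uk, va, us, vs} k (A i))
    (admissible : PathAlgebra.IsAdmissible
      (TwoSidedIdeal.span (QuiverRelation.toPathAlgebra '' I))) (i : Γ) :
    GBPAlgebra π I →+* A i :=
  RingCon.lift _ (GPathAlgebra.toVertex k (A := A) i).toRingHom (by
    intro x y hxy
    have h := toVertex_eq_zero_of_mem_span admissible i ((TwoSidedIdeal.rel_iff _ _ _).1 hxy)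
    rw [map_sub] at h
    exact sub_eq_zero.1 h)

theorem toVertex_mk (admissible : PathAlgebra.IsAdmissible
      (TwoSidedIdeal.span (QuiverRelation.toPathAlgebra '' I))) (i : Γ) (f : GPathAlgebra k A) :
    toVertex π admissible i (mk π I f) = GPathAlgebra.toVertex k i f := rfl

theorem toVertex_ofVertex (admissible : PathAlgebra.IsAdmissible
      (TwoSidedIdeal.span (QuiverRelation.toPathAlgebra '' I))) (i : Γ) (a : A i) :
    toVertex π admissible i (ofVertex π I i a) = a :=
  GPathAlgebra.toVertex_ofPath _

theorem toVertex_ofVertex_of_ne (admissible : PathAlgebra.IsAdmissible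
      (TwoSidedIdeal.span (QuiverRelation.toPathAlgebra '' I))) {i l : Γ} (h : l ≠ i) (a : A l) :
    toVertex π admissible i (ofVertex π I l a) = 0 :=
  GPathAlgebra.toVertex_ofPath_of_ne h.symm _

theorem ofVertex_zero (i : Γ) : ofVertex π I i 0 = 0 := by
  have h := ofVertex_smul π I i (0 : k) 0
  rwa [zero_smul, zero_smul] at h

/-- Lift `y` to `k(Γ,𝒜)`: the corner retains only the component from `i` to `i`, which by acyclicity
is spanned by length-zero `𝒜`-paths, and on these taking the entry loses nothing. Together with
`toVertex_ofVertex` this identifies the corner of `Λ` at `i` with `A_i`. -/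
theorem ofVertex_one_mul_mul_ofVertex_one
    (acyclic : ∀ (i : Γ) (p : Quiver.Path i i), p.length = 0)
    (admissible : PathAlgebra.IsAdmissible
      (TwoSidedIdeal.span (QuiverRelation.toPathAlgebra '' I))) (i : Γ) (y : GBPAlgebra π I) :
    ofVertex π I i 1 * y * ofVertex π I i 1 =
      ofVertex π I i (toVertex π admissible i y) := by
  obtain ⟨f, rfl⟩ := mk_surjective π I y
  change mk π I _ * mk π I f * mk π I _ = _
  rw [← map_mul, ← map_mul, GPathAlgebra.ofVertex_mul_mul_ofVertex, toVertex_mk]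
  change _ = ofVertex π I i (GPathHom.nilPart i i (f i i))
  generalize f i i = g
  induction g using GPathHom.induction k with
  | zero =>
    rw [map_zero, map_zero, map_zero, ofVertex_zero]
  | add g₁ g₂ h₁ h₂ => rw [map_add, map_add, map_add, h₁, h₂, ofVertex_add]
  | smul_mk c x =>
    obtain ⟨a, rfl⟩ := APath.exists_eq_nil acyclic x
    rw [map_smul, map_smul, map_smul, GPathHom.nilPart_mk, ofVertex_smul]
    rfl

end GBPAlgebra

end

/-! ## The radical of an indecomposable projective -/

theorem mem_rightIdeal_iff {R : Type*} [Ring R] {e x : R} (he : IsIdempotentElem e) :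
    x ∈ rightIdeal e ↔ e * x = x := by
  rw [Submodule.mem_span_singleton]
  constructor
  · rintro ⟨a, rfl⟩
    rw [← MulOpposite.op_unop a, op_smul_eq_mul, ← mul_assoc, he.eq]
  · intro h
    exact ⟨op x, by rw [op_smul_eq_mul, h]⟩

section

variable {k : Type uk} [Field k] {Γ : Type uΓ} [Quiver.{vv} Γ] {A : Γ → Type va}
  [∀ i, Ring (A i)] [∀ i, Algebra k (A i)] [Fintype Γ]
  {π : ∀ i, QuiverPresentation.{uk, va, us, vs} k (A i)} {I : Set (QuiverRelation k Γ)}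

namespace GBPAlgebra

theorem isIdempotentElem_ofVertex {i : Γ} {a : A i} (ha : IsIdempotentElem a) :
    IsIdempotentElem (ofVertex π I i a) := by
  rw [IsIdempotentElem, ofVertex_mul, ha.eq]

variable (admissible : PathAlgebra.IsAdmissible
      (TwoSidedIdeal.span (QuiverRelation.toPathAlgebra '' I)))

/-- The map `ēΛ → eA_i` induced by the projection `Λ → A_i`. -/
def projTop {i : Γ} {a : A i} (ha : IsIdempotentElem a) :
    rightIdeal (ofVertex π I i a) →ₛₗ[(toVertex π admissible i).op] rightIdeal a where
  toFun x := ⟨toVertex π admissible i x, by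
    rw [mem_rightIdeal_iff ha]
    have h := (mem_rightIdeal_iff (isIdempotentElem_ofVertex (π := π) (I := I) ha)).1 x.2
    conv_rhs => rw [← h, map_mul, toVertex_ofVertex]⟩
  map_add' x y := Subtype.ext (map_add _ _ _)
  map_smul' c x := Subtype.ext (by
    change toVertex π admissible i ((x : GBPAlgebra π I) * c.unop) =
      toVertex π admissible i x * toVertex π admissible i c.unop
    rw [map_mul])

theorem ofVertex_mem_rightIdeal {i : Γ} {a : A i} (ha : IsIdempotentElem a) {x : A i}
    (hx : x ∈ rightIdeal a) : ofVertex π I i x ∈ rightIdeal (ofVertex π I i a) := by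
  rw [mem_rightIdeal_iff (isIdempotentElem_ofVertex ha), ofVertex_mul,
    (mem_rightIdeal_iff ha).1 hx]

theorem projTop_surjective {i : Γ} {a : A i} (ha : IsIdempotentElem a) :
    Function.Surjective (projTop (π := π) admissible ha) := fun x =>
  ⟨⟨ofVertex π I i x, ofVertex_mem_rightIdeal ha x.2⟩,
    Subtype.ext (toVertex_ofVertex admissible i _)⟩

theorem ofVertex_one_mul_of_mem {i : Γ} {a : A i} (ha : IsIdempotentElem a) {x : GBPAlgebra π I}
    (hx : x ∈ rightIdeal (ofVertex π I i a)) : ofVertex π I i 1 * x = x := by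
  rw [← (mem_rightIdeal_iff (isIdempotentElem_ofVertex ha)).1 hx, ← mul_assoc, ofVertex_mul,
    one_mul]

/-- Here `x = 1_i x` and `b̄ = 1_i b̄`, so the product is `(1_i x 1_i) b̄` and the corner formula
applies. Thus multiplication into the vertex `i` sees `x` only through its image in `A_i`. -/
theorem mul_ofVertex_of_mem (acyclic : ∀ (i : Γ) (p : Quiver.Path i i), p.length = 0)
    {i : Γ} {a : A i} (ha : IsIdempotentElem a) {x : GBPAlgebra π I}
    (hx : x ∈ rightIdeal (ofVertex π I i a)) (b : A i) :
    x * ofVertex π I i b = ofVertex π I i (toVertex π admissible i x * b) := by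
  rw [← ofVertex_mul, ← ofVertex_one_mul_mul_ofVertex_one acyclic admissible,
    ofVertex_one_mul_of_mem ha hx, mul_assoc, ofVertex_mul, one_mul]

/-- A kernel element `x` generates a superfluous submodule: all its multiples are annihilated by
right multiplication by `ē`, while `ē` itself is fixed, so `x` cannot help to generate `ēΛ`. -/
theorem ker_projTop_le (acyclic : ∀ (i : Γ) (p : Quiver.Path i i), p.length = 0)
    {i : Γ} {a : A i} (ha : IsIdempotentElem a) :
    LinearMap.ker (projTop admissible ha) ≤
      rightRad (GBPAlgebra π I) (rightIdeal (ofVertex π I i a)) := by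
  intro x hx
  have hx0 : toVertex π admissible i x = 0 := congrArg Subtype.val (LinearMap.mem_ker.1 hx)
  refine Submodule.mem_sInf.2 fun K hK => ?_
  by_contra hxK
  -- The generator `ē`; maximality of `K` will express it as `κ + x c`.
  let E : rightIdeal (ofVertex π I i a) := ⟨_, Submodule.mem_span_singleton_self _⟩
  have hsup : K ⊔ Submodule.span _ {x} = ⊤ :=
    hK.2 _ (left_lt_sup.2 fun h => hxK (h (Submodule.mem_span_singleton_self x)))
  obtain ⟨κ, hκ, z, hz, hE⟩ := Submodule.mem_sup.1 (hsup ▸ Submodule.mem_top : E ∈ _)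
  obtain ⟨c, rfl⟩ := Submodule.mem_span_singleton.1 hz
  -- The element `x c ē` is the class of `τ(x) τ(c) a`, and `τ(x) = 0`.
  have hzero : op (ofVertex π I i a) • c • x = 0 := Subtype.ext (by
    change ((c • x : rightIdeal (ofVertex π I i a)) : GBPAlgebra π I) * ofVertex π I i a = 0
    rw [mul_ofVertex_of_mem admissible acyclic ha (c • x).2]
    change ofVertex π I i (toVertex π admissible i (x * c.unop) * a) = 0
    rw [map_mul, hx0, zero_mul, zero_mul, ofVertex_zero])
  have hEE : op (ofVertex π I i a) • E = E := Subtype.ext (isIdempotentElem_ofVertex ha).eq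
  -- Multiplying `ē = κ + x c` by `ē` on the right leaves `ē = κ ē`, which lies in `K`.
  have hEK : E ∈ K := by
    rw [← hEE, ← hE, smul_add, hzero, add_zero]
    exact K.smul_mem _ hκ
  refine hK.1 (eq_top_iff.2 fun y _ => ?_)
  have hy : y = op (y : GBPAlgebra π I) • E := Subtype.ext
    ((mem_rightIdeal_iff (isIdempotentElem_ofVertex ha)).1 y.2).symm
  rw [hy]
  exact K.smul_mem _ hEK

theorem mem_rightRad_iff (acyclic : ∀ (i : Γ) (p : Quiver.Path i i), p.length = 0)
    {i : Γ} {a : A i} (ha : IsIdempotentElem a) (x : rightIdeal (ofVertex π I i a)) :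
    x ∈ rightRad (GBPAlgebra π I) (rightIdeal (ofVertex π I i a)) ↔
      projTop admissible ha x ∈ rightRad (A i) (rightIdeal a) := by
  -- Comparing radicals along a semilinear map needs the map of scalars to be surjective; `ā` is a
  -- preimage of `a`.
  have hs : Function.Surjective (toVertex π admissible i).op := fun y =>
    ⟨op (ofVertex π I i y.unop), congrArg op (toVertex_ofVertex (π := π) admissible i _)⟩
  have : RingHomSurjective (toVertex π admissible i).op := ⟨hs⟩
  rw [rightRad, ← Module.comap_jacobson_of_ker_le (projTop_surjective admissible ha)
    (ker_projTop_le admissible acyclic ha), Submodule.mem_comap]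

/-- The case `b = 1` of `mul_ofVertex_of_mem`, as `y` is fixed by `1_i`. It gives the surjectivity
of `x ↦ x̄` onto the vertex space. -/
theorem ofVertex_toVertex_of_mem_vertexSpace
    (acyclic : ∀ (i : Γ) (p : Quiver.Path i i), p.length = 0)
    {i : Γ} {a : A i} (ha : IsIdempotentElem a) {y : rightIdeal (ofVertex π I i a)}
    (hy : y ∈ vertexSpace π I (rightIdeal (ofVertex π I i a)) i) :
    ofVertex π I i (toVertex π admissible i y) = y := by
  have h : (y : GBPAlgebra π I) * ofVertex π I i 1 = y :=
    congrArg Subtype.val (vertexSpace.smul_one π I hy)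
  rwa [mul_ofVertex_of_mem admissible acyclic ha y.2, mul_one] at h

/-- The isomorphism `eA_i ≃ ēΛ · 1_i`, `x ↦ x̄`. -/
def rightIdealEquiv (acyclic : ∀ (i : Γ) (p : Quiver.Path i i), p.length = 0)
    {i : Γ} {a : A i} (ha : IsIdempotentElem a) :
    rightIdeal a ≃ₗ[(A i)ᵐᵒᵖ] vertexSpace π I (rightIdeal (ofVertex π I i a)) i where
  toFun x := ⟨⟨ofVertex π I i x, ofVertex_mem_rightIdeal ha x.2⟩,
    ⟨⟨ofVertex π I i x, ofVertex_mem_rightIdeal ha x.2⟩, Subtype.ext (by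
      change ofVertex π I i x * ofVertex π I i 1 = ofVertex π I i x
      rw [ofVertex_mul, mul_one])⟩⟩
  map_add' x y := Subtype.ext (Subtype.ext (ofVertex_add π I i _ _))
  map_smul' c x := Subtype.ext (Subtype.ext (ofVertex_mul π I i _ _).symm)
  invFun y := projTop admissible ha y.1
  left_inv x := Subtype.ext (toVertex_ofVertex (π := π) admissible i (x : A i))
  right_inv y := Subtype.ext (Subtype.ext
    (ofVertex_toVertex_of_mem_vertexSpace admissible acyclic ha y.2))

theorem projTop_rightIdealEquiv (acyclic : ∀ (i : Γ) (p : Quiver.Path i i), p.length = 0)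
    {i : Γ} {a : A i} (ha : IsIdempotentElem a) (x : rightIdeal a) :
    projTop admissible ha (rightIdealEquiv (π := π) admissible acyclic ha x).1 = x :=
  (rightIdealEquiv (π := π) admissible acyclic ha).left_inv x

end GBPAlgebra

/-! ### Subrepresentations defined by submodules. -/

namespace GRep

variable {X : Type w} [AddCommGroup X] [Module k X] [Module (GBPAlgebra π I)ᵐᵒᵖ X]
  [IsScalarTower k (GBPAlgebra π I)ᵐᵒᵖ X]

/-- The subrepresentation of the representation of `X` defined by a submodule of `X`. -/
def Sub.ofSubmodule (Y : Submodule (GBPAlgebra π I)ᵐᵒᵖ X) : Sub (GRep.ofModule π I X) where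
  carrier l :=
    { carrier := {x | (x : vertexSpace π I X l).1 ∈ Y}
      add_mem' := fun hx hy => Y.add_mem hx hy
      zero_mem' := Y.zero_mem
      smul_mem' := fun _ _ hx => Y.smul_mem _ hx }
  stable _ _ hm := Y.smul_mem _ hm

/-- The representation of a submodule is isomorphic to the corresponding subrepresentation. -/
def Iso.ofSubmodule (Y : Submodule (GBPAlgebra π I)ᵐᵒᵖ X) :
    Iso (GRep.ofModule π I Y) (Sub.ofSubmodule Y).toRep where
  app l :=
    { toFun := fun x => ⟨(mapModule π I Y.subtype).app l x, (x : vertexSpace π I Y l).1.2⟩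
      map_add' := fun _ _ => rfl
      map_smul' := fun _ _ => rfl
      invFun := fun y => ⟨⟨y.1.1, y.2⟩,
        ⟨⟨y.1.1, y.2⟩, Subtype.ext (vertexSpace.smul_one π I y.1.2)⟩⟩
      left_inv := fun _ => rfl
      right_inv := fun _ => rfl }
  comm _ _ := rfl

end GRep

end

end

/-! ### The representation of the radical. -/

theorem proposition5p6 {k : Type uk} [Field k] [IsAlgClosed k]
    {Γ : Type uΓ} [Quiver.{vv} Γ] [Fintype Γ] [∀ i j : Γ, Finite (i ⟶ j)]
    (acyclic : ∀ (i : Γ) (p : Quiver.Path i i), p.length = 0)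
    {A : Γ → Type va} [∀ i, Ring (A i)] [∀ i, Algebra k (A i)]
    (π : ∀ i, QuiverPresentation.{uk, va, us, vs} k (A i))
    (I : Set (QuiverRelation k Γ))
    (admissible : PathAlgebra.IsAdmissible
      (TwoSidedIdeal.span (QuiverRelation.toPathAlgebra '' I)))
    (s : Γ → ℕ) (e : ∀ i, Fin (s i) → A i)
    (complete : ∀ i, CompleteOrthogonalIdempotents (e i))
    (primitive : ∀ i j, IsPrimitiveIdempotent (e i j))
    (i : Γ) (j : Fin (s i)) :
    let Λ := GBPAlgebra π I
    let Pij := rightIdeal (e i j)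
    let P := rightIdeal (GBPAlgebra.ofVertex π I i (e i j))
    let M := GRep.ofModule π I P
    ∃ ι : Pij ≃ₗ[(A i)ᵐᵒᵖ] vertexSpace π I P i,
      (∀ x : Pij, ((ι x : P) : Λ) = GBPAlgebra.ofVertex π I i (x : A i)) ∧
      ∃ N : GRep.Sub M,
        N.carrier i = (rightRad (A i) Pij).map ι.toLinearMap ∧
        (∀ l, l ≠ i → N.carrier l = ⊤) ∧
        ∃ f : GRep.Iso (GRep.ofModule π I (rightRad Λ P)) N.toRep,
          f.hom.comp N.incl = GRep.mapModule π I (rightRad Λ P).subtype := by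
  intro Λ Pij P M
  have he := (complete i).idem j
  -- The witness `N` is cut out at each vertex by `rad P`, so stability under the arrows is
  -- automatic and both morphisms in the last claim keep the underlying element. What needs proof is
  -- the shape of `N` at `i` and elsewhere.
  refine ⟨GBPAlgebra.rightIdealEquiv admissible acyclic he, fun _ => rfl,
    GRep.Sub.ofSubmodule (rightRad Λ P), ?_, ?_, GRep.Iso.ofSubmodule (rightRad Λ P), rfl⟩
  · ext y
    obtain ⟨x, rfl⟩ := (GBPAlgebra.rightIdealEquiv (π := π) admissible acyclic he).surjective y
    -- Membership of `ι x` in `rad P` is tested on its image in `eA_i`, which is `x` again.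
    refine (GBPAlgebra.mem_rightRad_iff admissible acyclic he _).trans ?_
    rw [GBPAlgebra.projTop_rightIdealEquiv]
    exact (Function.Injective.mem_set_image
      (GBPAlgebra.rightIdealEquiv (π := π) admissible acyclic he).injective).symm
  · intro l hl
    refine eq_top_iff.2 fun y _ => ?_
    refine GBPAlgebra.ker_projTop_le admissible acyclic he (LinearMap.mem_ker.2 (Subtype.ext ?_))
    change GBPAlgebra.toVertex π admissible i (y : vertexSpace π I P l).1.1 = 0
    -- Since `y = y · 1_l` and the projection to `A_i` kills `1_l`, it kills `y`.
    have h := congrArg Subtype.val (vertexSpace.smul_one π I (X := P) y.2)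
    change (y : vertexSpace π I P l).1.1 * GBPAlgebra.ofVertex π I l 1 = y.1.1 at h
    rw [← h, map_mul, GBPAlgebra.toVertex_ofVertex_of_ne admissible hl, mul_zero]
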